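/- For integers $n,k$, let $[n]=\{1,\dots,n\}$ and let $\binom{[n]}{k}$ be the collection of all $k$-element subsets of $[n]$. A family $\mathcal F\subset\binom{[n]}{k}$ is intersecting if any two of its members have non-empty intersection. The diversity of $\mathcal F$ is $\gamma(\mathcal F)=|\mathcal F|-\Delta(\mathcal F)$, where $\Delta(\mathcal F)=\max_{i\in[n]}|\{F\in\mathcal F: i\in F\}|$ is the maximal degree. Let $n>2k\ge 8$ and let $\mathcal F\subset\binom{[n]}{k}$ be an intersecting family. Suppose that $\gamma(\mathcal F)>\binom{n-u-1}{n-k-1}$ for some integer $4\le u\le k$. Then $$|\mathcal F|\le \binom{n-1}{k-1}+\binom{n-u-1}{n-k-1}-\binom{n-u-1}{k-1}-\binom{n-k-2}{k-2}+1.\qquad (*)$$ Moreover, for $n>2k\ge 6$ and an intersecting family $\mathcal F\subset\binom{[n]}{k}$, the inequality $(*)$ holds with $u=3$ if $$\binom{n-4}{k-3}<\gamma(\mathcal F)\le\binom{n-3}{k-2}-\binom{n-k-2}{k-2}+1$$ or $$\binom{n-3}{k-2}<\gamma(\mathcal F)\le\binom{n-3}{k-2}+\binom{n-4}{k-2}-\binom{n-k-2}{k-2}+1.$$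 -/

import Mathlib

/-- The degree of `i` in the family `F`: the number of members of `F` that contain `i`. -/
def familyDegree {n : ℕ} (F : Finset (Finset (Fin n))) (i : Fin n) : ℕ :=
  (F.filter (fun A => i ∈ A)).card

/-- The maximal degree of an element of the ground set in the family `F`. -/
def familyMaxDegree {n : ℕ} (F : Finset (Finset (Fin n))) : ℕ :=
  Finset.univ.sup (familyDegree F)

theorem familyMaxDegree_le_card {n : ℕ} (F : Finset (Finset (Fin n))) :
    familyMaxDegree F ≤ F.card :=
  Finset.sup_le fun _ _ => Finset.card_filter_le _ _

/-- The diversity of `F`: the number of members of `F` minus the maximal degree.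
The subtraction never truncates, by `familyMaxDegree_le_card`. -/
def diversity {n : ℕ} (F : Finset (Finset (Fin n))) : ℕ :=
  F.card - familyMaxDegree F

/-!
Take an element of maximal degree: the members containing it (with it removed) and those avoiding
it are cross-intersecting families of `Δ(F)` and `γ(F)` sets. By Kruskal–Katona only initial
segments need be considered, and for these the position of `γ(F)` among binomial coefficients
decides whether one passes to the sets containing the last point or to the sets avoiding it. In the
two ranges for `u = 3`, and for `u ≥ 4` if `γ(F) ≤ C(n - 4, k - 3)`, such steps lead to a
cross-intersecting pair for which the Hilton–Milner bound is the claim.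

If `γ(F) > C(n - 4, k - 3)`, then `#F ≤ C(n - 2, k - 2) + 2 C(n - 3, k - 2)`, which implies the
claim for all `u ≥ 4`. As long as `γ(F) ≤ C(n - 3, k - 2) + C(n - 4, k - 2)`, this again follows
from the two sizes. Otherwise one may shift `F`: a shift keeps the size and leaves the diversity
above `C(n - 4, k - 3)`. For shifted `F`, the members avoiding both `0` and `1` and the members
containing both obey a Katona-type bound. The members containing exactly one of them give two
cross-intersecting families, each containing the shadow of the members avoiding both; by the local
LYM inequality both are large, and then the sum of their sizes is small.
-/

open Finset
open scoped FinsetFamily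

section Families

variable {α : Type*}

/-- Two families of sets are cross-intersecting if every member of the first meets every member
of the second. -/
def CrossIntersecting (A B : Finset (Finset α)) : Prop :=
  ∀ X ∈ A, ∀ Y ∈ B, ¬ Disjoint X Y

theorem CrossIntersecting.symm {A B : Finset (Finset α)} (h : CrossIntersecting A B) :
    CrossIntersecting B A :=
  fun Y hY X hX hYX => h X hX Y hY hYX.symm

variable [DecidableEq α]

theorem CrossIntersecting.of_intersecting {F : Finset (Finset α)}
    (h : (F : Set (Finset α)).Intersecting) : CrossIntersecting F F :=
  fun _ hX _ hY => h hX hY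

theorem CrossIntersecting.memberSubfamily_nonMemberSubfamily {A B : Finset (Finset α)}
    (h : CrossIntersecting A B) (x : α) :
    CrossIntersecting (A.memberSubfamily x) (B.nonMemberSubfamily x) := by
  intro X hX Y hY hXY
  rw [mem_memberSubfamily] at hX
  rw [mem_nonMemberSubfamily] at hY
  exact h _ hX.1 _ hY.1 (disjoint_insert_left.2 ⟨hY.2, hXY⟩)

theorem CrossIntersecting.nonMemberSubfamily_memberSubfamily {A B : Finset (Finset α)}
    (h : CrossIntersecting A B) (x : α) :
    CrossIntersecting (A.nonMemberSubfamily x) (B.memberSubfamily x) :=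
  (h.symm.memberSubfamily_nonMemberSubfamily x).symm

theorem memberSubfamily_subset_powersetCard_erase {F : Finset (Finset α)} {r : ℕ} {S : Finset α}
    (hF : F ⊆ powersetCard (r + 1) S) (x : α) :
    F.memberSubfamily x ⊆ powersetCard r (S.erase x) := by
  intro X hX
  rw [mem_memberSubfamily] at hX
  have hins := mem_powersetCard.1 (hF hX.1)
  rw [card_insert_of_notMem hX.2, add_left_inj] at hins
  exact mem_powersetCard.2 ⟨subset_erase.2 ⟨(subset_insert _ _).trans hins.1, hX.2⟩, hins.2⟩

theorem nonMemberSubfamily_subset_powersetCard_erase {F : Finset (Finset α)} {r : ℕ}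
    {S : Finset α} (hF : F ⊆ powersetCard r S) (x : α) :
    F.nonMemberSubfamily x ⊆ powersetCard r (S.erase x) := by
  intro X hX
  rw [mem_nonMemberSubfamily] at hX
  have hXS := mem_powersetCard.1 (hF hX.1)
  exact mem_powersetCard.2 ⟨subset_erase.2 ⟨hXS.1, hX.2⟩, hXS.2⟩

theorem card_memberSubfamily_le_choose {F : Finset (Finset α)} {r : ℕ} {S : Finset α}
    (hF : F ⊆ powersetCard (r + 1) S) {x : α} (hx : x ∈ S) :
    #(F.memberSubfamily x) ≤ (#S - 1).choose r := by
  rw [← card_erase_of_mem hx, ← card_powersetCard]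
  exact card_le_card (memberSubfamily_subset_powersetCard_erase hF x)

theorem crossIntersecting_iff_disjoint_shadow_iterate_compls [Fintype α] {a b : ℕ}
    {A B : Finset (Finset α)} (hA : A ⊆ powersetCard a univ) (hB : B ⊆ powersetCard b univ)
    (hab : a + b ≤ Fintype.card α) :
    CrossIntersecting A B ↔ Disjoint A (∂^[Fintype.card α - b - a] Bᶜˢ) := by
  rw [disjoint_left]
  refine forall₂_congr fun X hX => ?_
  simp only [mem_shadow_iterate_iff_exists_mem_card_add, mem_compls, not_exists, not_and]
  rw [compl_surjective.forall]
  refine forall₂_congr fun Y hY => ?_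
  have hXa := mem_powersetCard_univ.1 (hA hX)
  have hYb := mem_powersetCard_univ.1 (hB hY)
  rw [card_compl] at hYb
  have hYα := card_le_univ Y
  rw [← subset_compl_iff_disjoint_right, compl_compl]
  have hcard : #Y = #X + (Fintype.card α - b - a) := by omega
  tauto

end Families

theorem exists_subset_card_eq_forall_lt_mem {β : Type*} [LinearOrder β] (P : Finset β) {t : ℕ}
    (ht : t ≤ #P) : ∃ C ⊆ P, #C = t ∧ ∀ x ∈ C, ∀ y ∈ P, y < x → y ∈ C := by
  induction P using Finset.induction_on_max with
  | empty => exact ⟨∅, subset_rfl, (Nat.le_zero.1 ht).symm, by simp⟩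
  | insert m P hm ih =>
    have hmP : m ∉ P := fun h => (hm m h).false
    rw [card_insert_of_notMem hmP] at ht
    rcases ht.lt_or_eq with ht | rfl
    · obtain ⟨C, hCP, hC, hlt⟩ := ih (Nat.lt_succ_iff.1 ht)
      refine ⟨C, hCP.trans (subset_insert m P), hC, fun x hx y hy hyx => ?_⟩
      refine hlt x hx y ((mem_insert.1 hy).resolve_left ?_) hyx
      exact (hyx.trans (hm x (hCP hx))).ne
    · exact ⟨insert m P, subset_rfl, card_insert_of_notMem hmP, fun x _ y hy _ => hy⟩

theorem exists_isInitSeg_card_eq {α : Type*} [LinearOrder α] [Fintype α] {r t : ℕ}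
    (ht : t ≤ (Fintype.card α).choose r) :
    ∃ C : Finset (Finset α), Colex.IsInitSeg C r ∧ #C = t := by
  obtain ⟨C, hC, rfl, hlt⟩ := exists_subset_card_eq_forall_lt_mem
    ((powersetCard r (univ : Finset α)).map toColex.toEmbedding) (t := t) (by simpa using ht)
  refine ⟨C.map ofColex.toEmbedding, ⟨fun X hX => ?_, fun X Y hX hY => ?_⟩, card_map _⟩
  · simpa using hC (mem_map_equiv.1 hX)
  · exact mem_map_equiv.2 (hlt _ (mem_map_equiv.1 hX) _ (by simpa using hY.2) hY.1)

section InitialSegments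

variable {N a b : ℕ}

theorem exists_crossIntersecting_isInitSeg_compls {A B : Finset (Finset (Fin N))}
    (hA : A ⊆ powersetCard a univ) (hB : B ⊆ powersetCard b univ) (hAB : CrossIntersecting A B)
    (hab : a + b ≤ N) {t : ℕ} (ht : t ≤ #B) :
    ∃ A' ⊆ powersetCard a univ, ∃ B' ⊆ powersetCard b (univ : Finset (Fin N)),
      CrossIntersecting A' B' ∧ Colex.IsInitSeg B'ᶜˢ (N - b) ∧ #A ≤ #A' ∧ #B' = t := by
  have hBc : (Bᶜˢ : Set (Finset (Fin N))).Sized (N - b) := by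
    simpa using (subset_powersetCard_univ_iff.1 hB).compls
  obtain ⟨C, hC, hCt⟩ := exists_isInitSeg_card_eq (α := Fin N) (r := N - b) (t := t)
    (ht.trans (by simpa using hBc.card_le))
  have hCb : Cᶜˢ ⊆ powersetCard b univ := by
    rw [subset_powersetCard_univ_iff]
    simpa [Nat.sub_sub_self (show b ≤ N by omega)] using hC.1.compls
  have shadow_subset {D : Finset (Finset (Fin N))} (hD : (D : Set (Finset (Fin N))).Sized (N - b)) :
      ∂^[N - b - a] D ⊆ powersetCard a univ := by
    rw [subset_powersetCard_univ_iff]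
    have hDa := hD.shadow_iterate (k := N - b - a)
    rwa [Nat.sub_sub_self (Nat.le_sub_of_add_le hab)] at hDa
  refine ⟨powersetCard a univ \ ∂^[N - b - a] C, sdiff_subset, Cᶜˢ, hCb, ?_, by simpa using hC, ?_,
    by simpa using hCt⟩
  · rw [crossIntersecting_iff_disjoint_shadow_iterate_compls sdiff_subset hCb (by simpa using hab)]
    simpa using sdiff_disjoint
  have hA_sub : A ⊆ powersetCard a univ \ ∂^[N - b - a] Bᶜˢ := by
    refine subset_sdiff.2 ⟨hA, ?_⟩
    simpa using (crossIntersecting_iff_disjoint_shadow_iterate_compls hA hB (by simpa)).1 hAB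
  calc #A ≤ #(powersetCard a univ \ ∂^[N - b - a] Bᶜˢ) := card_le_card hA_sub
    _ = #(powersetCard a (univ : Finset (Fin N))) - #(∂^[N - b - a] Bᶜˢ) :=
      card_sdiff_of_subset (shadow_subset hBc)
    _ ≤ #(powersetCard a (univ : Finset (Fin N))) - #(∂^[N - b - a] C) :=
      Nat.sub_le_sub_left (iterated_kk hBc (by simpa [hCt] using ht) hC) _
    _ = #(powersetCard a univ \ ∂^[N - b - a] C) := (card_sdiff_of_subset (shadow_subset hC.1)).symm

theorem toColex_lt_toColex_of_last {X Y : Finset (Fin (N + 1))} (hX : Fin.last N ∈ X)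
    (hY : Fin.last N ∉ Y) : toColex Y < toColex X := by
  rw [Colex.toColex_lt_toColex_iff_exists_forall_lt]
  exact ⟨Fin.last N, hX, hY, fun y hy _ => Fin.lt_last_iff_ne_last.2 (ne_of_mem_of_not_mem hy hY)⟩

theorem powersetCard_subset_memberSubfamily_last {B : Finset (Finset (Fin (N + 1)))}
    (hB : Colex.IsInitSeg Bᶜˢ (N - b)) (hne : (B.nonMemberSubfamily (Fin.last N)).Nonempty) :
    powersetCard b (univ.erase (Fin.last N)) ⊆ B.memberSubfamily (Fin.last N) := by
  obtain ⟨Y, hY⟩ := hne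
  rw [mem_nonMemberSubfamily] at hY
  intro X hX
  rw [mem_powersetCard, subset_erase] at hX
  suffices (insert (Fin.last N) X)ᶜ ∈ Bᶜˢ from mem_memberSubfamily.2 ⟨by simpa using this, hX.1.2⟩
  refine hB.2 (s := Yᶜ) (by simpa using hY.1) ⟨?_, ?_⟩
  · exact toColex_lt_toColex_of_last (by simpa using hY.2) (by simp)
  · rw [card_compl, card_insert_of_notMem hX.1.2, hX.2, Fintype.card_fin, Nat.add_sub_add_right]

end InitialSegments

theorem card_powersetCard_erase_last (N r : ℕ) :
    #(powersetCard r (univ.erase (Fin.last N))) = N.choose r := by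
  simp

/-- There are cross-intersecting families on an `N`-element set, one of at least `s` sets of
size `a` and one of at least `t` sets of size `b`. Only the cardinalities are recorded, since the
arguments below repeatedly replace the two families by extremal ones. -/
def CrossIntersectingSizes (N a b s t : ℕ) : Prop :=
  ∃ A ⊆ powersetCard a univ, ∃ B ⊆ powersetCard b (univ : Finset (Fin N)),
    CrossIntersecting A B ∧ s ≤ #A ∧ t ≤ #B

namespace CrossIntersectingSizes

theorem of_finset {α : Type*} {N a b : ℕ} {S : Finset α} (hS : #S = N)
    {A B : Finset (Finset α)} (hA : A ⊆ powersetCard a S) (hB : B ⊆ powersetCard b S)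
    (hAB : CrossIntersecting A B) : CrossIntersectingSizes N a b #A #B := by
  let f : Fin N ↪ α := (S.equivFinOfCardEq hS).symm.toEmbedding.trans (.subtype _)
  have hf : univ.map f = S := by
    rw [← map_map, map_univ_equiv, univ_eq_attach, attach_map_val]
  rw [← hf, powersetCard_map, subset_map_iff] at hA hB
  obtain ⟨A, hA, rfl⟩ := hA
  obtain ⟨B, hB, rfl⟩ := hB
  refine ⟨A, hA, B, hB, fun X hX Y hY hXY => ?_, (card_map _).le, (card_map _).le⟩
  exact hAB _ (mem_map_of_mem _ hX) _ (mem_map_of_mem _ hY) ((disjoint_map f).2 hXY)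

variable {N a b s t s' t' : ℕ}

theorem mono (h : CrossIntersectingSizes N a b s t) (hs : s' ≤ s) (ht : t' ≤ t) :
    CrossIntersectingSizes N a b s' t' := by
  obtain ⟨A, hA, B, hB, hAB, hsA, htB⟩ := h
  exact ⟨A, hA, B, hB, hAB, hs.trans hsA, ht.trans htB⟩

theorem symm (h : CrossIntersectingSizes N a b s t) : CrossIntersectingSizes N b a t s := by
  obtain ⟨A, hA, B, hB, hAB, hsA, htB⟩ := h
  exact ⟨B, hB, A, hA, hAB.symm, htB, hsA⟩

theorem right_le (h : CrossIntersectingSizes N a b s t) : t ≤ N.choose b := by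
  obtain ⟨A, -, B, hB, -, -, htB⟩ := h
  simpa using htB.trans (card_le_card hB)

theorem left_le (h : CrossIntersectingSizes N a b s t) : s ≤ N.choose a :=
  h.symm.right_le

theorem exists_isInitSeg_compls (h : CrossIntersectingSizes N a b s t) (hab : a + b ≤ N) :
    ∃ A ⊆ powersetCard a univ, ∃ B ⊆ powersetCard b (univ : Finset (Fin N)),
      CrossIntersecting A B ∧ Colex.IsInitSeg Bᶜˢ (N - b) ∧ s ≤ #A ∧ #B = t := by
  obtain ⟨A₀, hA₀, B₀, hB₀, hAB₀, hsA₀, htB₀⟩ := h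
  obtain ⟨A, hA, B, hB, hAB, hBinit, hle, hBt⟩ :=
    exists_crossIntersecting_isInitSeg_compls hA₀ hB₀ hAB₀ hab htB₀
  exact ⟨A, hA, B, hB, hAB, hBinit, hsA₀.trans hle, hBt⟩

/-- If `B` has at most as many members as there are sets through the last point, all members of an
extremal `B` contain the last point. -/
theorem link (h : CrossIntersectingSizes (N + 1) (a + 1) (b + 1) s t) (hab : a + b + 1 ≤ N)
    (ht : t ≤ N.choose b) : CrossIntersectingSizes N (a + 1) b (s - N.choose a) t := by
  obtain ⟨A, hA, B, hB, hAB, hinit, hs, rfl⟩ := h.exists_isInitSeg_compls (by omega)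
  rw [Nat.add_sub_add_right] at hinit
  have hBcard := card_memberSubfamily_add_card_nonMemberSubfamily (Fin.last N) B
  have hBempty : B.nonMemberSubfamily (Fin.last N) = ∅ := by
    by_contra hne
    rw [← ne_eq, ← nonempty_iff_ne_empty] at hne
    have hle := card_le_card (powersetCard_subset_memberSubfamily_last hinit hne)
    rw [card_powersetCard_erase_last] at hle
    have := hne.card_pos
    omega
  have hAcard := card_memberSubfamily_add_card_nonMemberSubfamily (Fin.last N) A
  have hAle := card_memberSubfamily_le_choose hA (mem_univ (Fin.last N))
  rw [card_fin, Nat.add_sub_cancel] at hAle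
  rw [hBempty, card_empty] at hBcard
  exact (of_finset (by simp) (nonMemberSubfamily_subset_powersetCard_erase hA _)
    (memberSubfamily_subset_powersetCard_erase hB _)
    (hAB.nonMemberSubfamily_memberSubfamily (Fin.last N))).mono (by omega) hBcard.ge

/-- If `B` has at least as many members as there are sets through the last point, an extremal `B`
contains all of these, which forces every member of `A` to contain the last point. -/
theorem deletion (h : CrossIntersectingSizes (N + 1) (a + 1) (b + 1) s t) (hab : a + b + 1 ≤ N)
    (ht : N.choose b ≤ t) : CrossIntersectingSizes N a (b + 1) s (t - N.choose b) := by
  obtain ⟨A, hA, B, hB, hAB, hinit, hs, rfl⟩ := h.exists_isInitSeg_compls (by omega)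
  rw [Nat.add_sub_add_right] at hinit
  have hBcard := card_memberSubfamily_add_card_nonMemberSubfamily (Fin.last N) B
  have hBle := card_memberSubfamily_le_choose hB (mem_univ (Fin.last N))
  rw [card_fin, Nat.add_sub_cancel] at hBle
  have hBfull : powersetCard b (univ.erase (Fin.last N)) ⊆ B.memberSubfamily (Fin.last N) := by
    rcases (B.nonMemberSubfamily (Fin.last N)).eq_empty_or_nonempty with hempty | hne
    · refine (eq_of_subset_of_card_le (memberSubfamily_subset_powersetCard_erase hB _) ?_).ge
      rw [hempty, card_empty] at hBcard
      rw [card_powersetCard_erase_last]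
      omega
    · exact powersetCard_subset_memberSubfamily_last hinit hne
  have hAempty : A.nonMemberSubfamily (Fin.last N) = ∅ := by
    refine eq_empty_of_forall_notMem fun X hX => ?_
    have hXa := mem_powersetCard.1 (nonMemberSubfamily_subset_powersetCard_erase hA _ hX)
    obtain ⟨Y, hY, hYb⟩ := exists_subset_card_eq (s := univ.erase (Fin.last N) \ X) (n := b) (by
      rw [card_sdiff_of_subset hXa.1, hXa.2, card_erase_of_mem (mem_univ _), card_fin]
      omega)
    exact hAB.nonMemberSubfamily_memberSubfamily (Fin.last N) X hX Y
      (hBfull (mem_powersetCard.2 ⟨hY.trans sdiff_subset, hYb⟩)) (disjoint_sdiff.mono_right hY)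
  have hAcard := card_memberSubfamily_add_card_nonMemberSubfamily (Fin.last N) A
  rw [hAempty, card_empty] at hAcard
  exact (of_finset (by simp) (memberSubfamily_subset_powersetCard_erase hA _)
    (nonMemberSubfamily_subset_powersetCard_erase hB _)
    (hAB.memberSubfamily_nonMemberSubfamily (Fin.last N))).mono (by omega) (by omega)

end CrossIntersectingSizes

section Binomials

theorem choose_le_choose_of_add_le {n i j : ℕ} (hij : i ≤ j) (hn : i + j ≤ n) :
    n.choose i ≤ n.choose j := by
  have choose_le_of_le_half {l : ℕ} (hil : i ≤ l) : l ≤ n / 2 → n.choose i ≤ n.choose l := by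
    induction l, hil using Nat.le_induction with
    | base => exact fun _ => le_rfl
    | succ l _ ih => exact fun h => (ih (by omega)).trans (Nat.choose_le_succ_of_lt_half_left h)
  by_cases hj : j ≤ n / 2
  · exact choose_le_of_le_half hij hj
  · by_cases hjn : j ≤ n
    · rw [← Nat.choose_symm hjn]
      exact choose_le_of_le_half (by omega) (by omega)
    · omega

theorem choose_add_choose_sub_le {m a b : ℕ} (hab : a < b) (hm : a + b ≤ m) :
    m.choose a + (m - a).choose b ≤ m.choose b + 1 := by
  induction a generalizing m with
  | zero => simp [add_comm]
  | succ a ih =>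
    obtain ⟨m, rfl⟩ := Nat.exists_eq_add_one_of_ne_zero (show m ≠ 0 by omega)
    obtain ⟨b, rfl⟩ := Nat.exists_eq_add_one_of_ne_zero (show b ≠ 0 by omega)
    have hsub := ih (m := m) (by omega) (by omega)
    have hle : m.choose (a + 1) ≤ m.choose b := choose_le_choose_of_add_le (by omega) (by omega)
    rw [Nat.choose_succ_succ', Nat.choose_succ_succ', Nat.add_sub_add_right]
    omega

end Binomials

namespace CrossIntersectingSizes

variable {m a b s t : ℕ}

theorem left_eq_zero (h : CrossIntersectingSizes m a 0 s t) (ht : 1 ≤ t) : s = 0 := by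
  obtain ⟨A, -, B, hB, hAB, hsA, htB⟩ := h
  obtain ⟨Y, hY⟩ := card_pos.1 (ht.trans htB)
  have hY0 : Y = ∅ := card_eq_zero.1 (mem_powersetCard.1 (hB hY)).2
  have hA : A = ∅ := eq_empty_of_forall_notMem fun X hX =>
    hAB X hX Y hY (hY0 ▸ disjoint_empty_right X)
  simpa [hA] using hsA

/-- The **Hilton–Milner bound** for non-empty cross-intersecting families. -/
theorem add_le_of_pos (h : CrossIntersectingSizes m b a s t) (hab : a ≤ b) (hm : a + b ≤ m)
    (hs : 1 ≤ s) (ht : 1 ≤ t) : s + t + (m - a).choose b ≤ m.choose b + 1 := by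
  induction m generalizing a b s t with
  | zero =>
    obtain rfl : a = 0 := by omega
    exact absurd (h.left_eq_zero ht) (by omega)
  | succ m ih =>
    rcases a with _ | a
    · exact absurd (h.left_eq_zero ht) (by omega)
    obtain ⟨b, rfl⟩ := Nat.exists_eq_add_one_of_ne_zero (show b ≠ 0 by omega)
    rw [Nat.add_sub_add_right]
    have le_of_le_choose {s t : ℕ} (h : CrossIntersectingSizes (m + 1) (b + 1) (a + 1) s t)
        (ht : 1 ≤ t) (hta : t ≤ m.choose a) :
        s + t + (m - a).choose (b + 1) ≤ (m + 1).choose (b + 1) + 1 := by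
      have hlink := h.link (by omega) hta
      rcases Nat.eq_zero_or_pos (s - m.choose b) with hzero | hpos
      · have := choose_add_choose_sub_le (m := m) (show a < b + 1 by omega) (by omega)
        have := Nat.choose_succ_succ' m b
        omega
      · have := ih hlink (by omega) (by omega) hpos ht
        have := Nat.choose_succ_succ' m b
        omega
    rcases Nat.lt_or_ge (m.choose a) t with hta | hta
    · have hdel := h.deletion (by omega) hta.le
      rcases hab.lt_or_eq with hlt | heq
      · have := ih hdel (by omega) (by omega) hs (by omega)
        have := choose_add_choose_sub_le (m := m) (show a < b + 1 by omega) (by omega)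
        have := Nat.choose_succ_succ' m b
        have : 0 < (m - (a + 1)).choose b := Nat.choose_pos (by omega)
        omega
      · obtain rfl : a = b := by omega
        rw [add_comm s]
        exact le_of_le_choose h.symm hs hdel.left_le
    · exact le_of_le_choose h ht hta

theorem add_le_of_le (h : CrossIntersectingSizes m b a s t) (hab : a ≤ b) (hm : a + b ≤ m)
    (ht : 1 ≤ t) (htb : t + (m - a).choose b ≤ m.choose b + 1) :
    s + t + (m - a).choose b ≤ m.choose b + 1 := by
  rcases Nat.eq_zero_or_pos s with rfl | hs
  · rwa [zero_add]
  · exact h.add_le_of_pos hab hm hs ht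

theorem add_le_of_lt (h : CrossIntersectingSizes m b a s t) (hab : a < b) (hm : a + b ≤ m)
    (ht : 1 ≤ t) : s + t + (m - a).choose b ≤ m.choose b + 1 :=
  h.add_le_of_le hab.le hm ht <| by
    have := h.right_le
    have := choose_add_choose_sub_le hab hm
    omega

theorem add_le_choose (h : CrossIntersectingSizes m a a s t) (hm : a + a ≤ m) :
    s + t ≤ m.choose a := by
  rcases Nat.eq_zero_or_pos s with rfl | hs
  · simpa using h.right_le
  rcases Nat.eq_zero_or_pos t with rfl | ht
  · exact h.left_le
  have := h.add_le_of_pos le_rfl hm hs ht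
  have : 0 < (m - a).choose a := Nat.choose_pos (by omega)
  omega

theorem iterated_link {r : ℕ} (h : CrossIntersectingSizes (m + r) (a + 1) (b + r) s t)
    (hab : a + b + 1 ≤ m) (ht : t ≤ m.choose b) :
    CrossIntersectingSizes m (a + 1) b (s + m.choose (a + 1) - (m + r).choose (a + 1)) t := by
  induction r generalizing s with
  | zero => exact h.mono (by simp) le_rfl
  | succ r ih =>
    have choose_le (i : ℕ) : m.choose b ≤ (m + i).choose (b + i) := by
      induction i with
      | zero => exact le_rfl
      | succ i ih => exact ih.trans <|
        (Nat.le_add_right _ _).trans (Nat.choose_succ_succ' _ _).ge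
    have hlink := link (N := m + r) (b := b + r) h (by omega) (ht.trans (choose_le r))
    refine (ih hlink).mono ?_ le_rfl
    have := Nat.choose_succ_succ' (m + r) a
    rw [← add_assoc]
    omega

end CrossIntersectingSizes

namespace CrossIntersectingSizes

variable {m r a c s t : ℕ}

theorem iterated_link_deletion (h : CrossIntersectingSizes (m + 1 + r) (a + 1) (c + 1 + r) s t)
    (hm : a + c + 1 ≤ m) (hct : m.choose c ≤ t) (htc : t ≤ (m + 1).choose (c + 1)) :
    CrossIntersectingSizes m a (c + 1)
      (s + (m + 1).choose (a + 1) - (m + 1 + r).choose (a + 1)) (t - m.choose c) :=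
  (h.iterated_link (by omega) htc).deletion hm hct

theorem add_le_of_choose_lt_of_le (h : CrossIntersectingSizes (m + 1 + r) (a + 1) (c + 1 + r) s t)
    (hca : c + 1 < a) (hm : a + c + 1 ≤ m) (hct : m.choose c < t)
    (htc : t ≤ (m + 1).choose (c + 1)) :
    s + t + m.choose (a + 1) + (m - (c + 1)).choose a
      ≤ (m + 1 + r).choose (a + 1) + m.choose c + 1 := by
  have hHM := (h.iterated_link_deletion hm hct.le htc).add_le_of_lt hca (by omega) (by omega)
  have hpascal := Nat.choose_succ_succ' m a
  omega

theorem of_first_range (h : CrossIntersectingSizes (m + 3) (c + 2) (c + 3) s t)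
    (hm : 2 * c + 2 ≤ m) (hct : m.choose c ≤ t) (htc : t ≤ (m + 1).choose (c + 1)) :
    CrossIntersectingSizes m (c + 1) (c + 1)
      (s - ((m + 2).choose (c + 1) + (m + 1).choose (c + 1))) (t - m.choose c) := by
  have pascal₁ : (m + 3).choose (c + 2) = (m + 2).choose (c + 1) + (m + 2).choose (c + 2) :=
    Nat.choose_succ_succ' _ _
  have pascal₂ : (m + 2).choose (c + 2) = (m + 1).choose (c + 1) + (m + 1).choose (c + 2) :=
    Nat.choose_succ_succ' _ _
  refine (iterated_link_deletion (r := 2) h (by omega) hct htc).mono ?_ le_rfl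
  change _ ≤ s + (m + 1).choose (c + 2) - (m + 3).choose (c + 2)
  omega

theorem of_second_range (h : CrossIntersectingSizes (m + 3) (c + 2) (c + 3) s t)
    (hm : 2 * c + 2 ≤ m) (hct : (m + 1).choose (c + 1) ≤ t)
    (htc : t ≤ (m + 1).choose (c + 1) + m.choose (c + 1)) :
    CrossIntersectingSizes m (c + 1) (c + 1)
      (s - ((m + 2).choose (c + 1) + m.choose c)) (t - (m + 1).choose (c + 1)) := by
  have hle : t ≤ (m + 2).choose (c + 2) := by
    rw [Nat.choose_succ_succ' (m + 1), Nat.choose_succ_succ' m (c + 1)]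
    omega
  have hlink := link (N := m + 2) (b := c + 2) h (by omega) hle
  have hdel := deletion (N := m + 1) (b := c + 1) hlink (by omega) hct
  exact (link (b := c + 1) hdel (by omega) (by omega)).mono (by omega) le_rfl

theorem add_le_of_le_choose_add_choose (h : CrossIntersectingSizes (m + 3) (c + 2) (c + 3) s t)
    (hm : 2 * c + 2 ≤ m) (hct : m.choose c ≤ t)
    (htc : t ≤ (m + 1).choose (c + 1) + m.choose (c + 1)) :
    s + t ≤ (m + 2).choose (c + 1) + 2 * (m + 1).choose (c + 1) := by
  have hpascal := Nat.choose_succ_succ' m c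
  rcases Nat.le_total t ((m + 1).choose (c + 1)) with htc' | hct'
  · have := (h.of_first_range hm hct htc').add_le_choose (by omega)
    omega
  · have := (h.of_second_range hm hct' htc).add_le_choose (by omega)
    omega

theorem add_le_of_first_or_second_range (h : CrossIntersectingSizes (m + 3) (c + 2) (c + 3) s t)
    (hm : 2 * c + 2 ≤ m)
    (ht : m.choose c < t ∧ t + (m - (c + 1)).choose (c + 1) ≤ (m + 1).choose (c + 1) + 1 ∨
      (m + 1).choose (c + 1) < t ∧
        t + (m - (c + 1)).choose (c + 1) ≤ (m + 1).choose (c + 1) + m.choose (c + 1) + 1) :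
    s + t + (m - (c + 1)).choose (c + 1)
      ≤ (m + 2).choose (c + 1) + 2 * (m + 1).choose (c + 1) + 1 := by
  have hpascal := Nat.choose_succ_succ' m c
  have hpos : 0 < (m - (c + 1)).choose (c + 1) := Nat.choose_pos (by omega)
  rcases ht with ⟨hct, htc⟩ | ⟨hct, htc⟩
  · have := (h.of_first_range hm hct.le (by omega)).add_le_of_le le_rfl (by omega) (by omega)
      (by omega)
    omega
  · have := (h.of_second_range hm hct.le (by omega)).add_le_of_le le_rfl (by omega) (by omega)
      (by omega)
    omega

theorem left_le_of_choose_le (h : CrossIntersectingSizes (m + 1) (a + 1) (c + 1) s t)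
    (hm : a + c + 1 ≤ m) (ht : m.choose c ≤ t) : s ≤ m.choose a :=
  (h.deletion hm ht).left_le

theorem add_le_two_mul_choose (h : CrossIntersectingSizes (m + 2) (c + 2) (c + 2) s t)
    (hm : 2 * c + 2 ≤ m) (hs : m.choose c ≤ s) (ht : m.choose c ≤ t) :
    s + t ≤ 2 * (m + 1).choose (c + 1) := by
  wlog htc : t ≤ (m + 1).choose (c + 1) generalizing s t
  · rw [add_comm]
    exact this h.symm ht hs (left_le_of_choose_le (m := m + 1) h (by omega) (not_le.1 htc).le)
  have hlink := link (N := m + 1) (b := c + 1) h (by omega) htc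
  have := (hlink.deletion (by omega) ht).add_le_choose (by omega)
  have := Nat.choose_succ_succ' m c
  omega

end CrossIntersectingSizes

section Shifted

variable {α : Type*} [LinearOrder α] {S : Finset α} {Z W : Finset (Finset α)} {x : α} {a b : ℕ}

/-- `F` is shifted on `S`: it is closed under replacing an element of a member by a smaller
element of `S`. Only the new element is required to lie in `S`. -/
def IsShiftedOn (S : Finset α) (F : Finset (Finset α)) : Prop :=
  ∀ A ∈ F, ∀ j ∈ A, ∀ i ∈ S, i ∉ A → i < j → insert i (A.erase j) ∈ F

theorem IsShiftedOn.nonMemberSubfamily (hZ : IsShiftedOn S Z) (x : α) :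
    IsShiftedOn (S.erase x) (Z.nonMemberSubfamily x) := by
  intro A hA j hj i hi hiA hij
  rw [mem_nonMemberSubfamily] at hA ⊢
  rw [mem_erase] at hi
  refine ⟨hZ A hA.1 j hj i hi.2 hiA hij, ?_⟩
  simp [hi.1.symm, hA.2]

theorem IsShiftedOn.memberSubfamily (hZ : IsShiftedOn S Z) (x : α) :
    IsShiftedOn (S.erase x) (Z.memberSubfamily x) := by
  intro A hA j hj i hi hiA hij
  rw [mem_memberSubfamily] at hA ⊢
  rw [mem_erase] at hi
  have hshift := hZ _ hA.1 j (mem_insert_of_mem hj) i hi.2 (by simp [hi.1, hiA]) hij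
  rw [erase_insert_of_ne (ne_of_mem_of_not_mem hj hA.2).symm, Finset.insert_comm] at hshift
  exact ⟨hshift, by simp [hi.1.symm, hA.2]⟩

theorem IsShiftedOn.insert_mem (hZ : IsShiftedOn (insert x S) Z) (hx : ∀ y ∈ S, y < x)
    {A : Finset α} (hA : A ∈ Z.memberSubfamily x) {c : α} (hc : c ∈ S) (hcA : c ∉ A) :
    insert c A ∈ Z := by
  rw [mem_memberSubfamily] at hA
  have hshift := hZ _ hA.1 x (mem_insert_self _ _) c (mem_insert_of_mem hc)
    (by simp [(hx c hc).ne, hcA]) (hx c hc)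
  rwa [erase_insert hA.2] at hshift

theorem IsShiftedOn.crossIntersecting_memberSubfamily (hZ : IsShiftedOn (insert x S) Z)
    (hx : ∀ y ∈ S, y < x) (hZW : CrossIntersecting Z W)
    (hcard : ∀ A ∈ Z.memberSubfamily x, ∀ B ∈ W.memberSubfamily x, #(A ∪ B) < #S) :
    CrossIntersecting (Z.memberSubfamily x) (W.memberSubfamily x) := by
  intro A hA B hB hAB
  obtain ⟨c, hc, hcAB⟩ := exists_mem_notMem_of_card_lt_card (hcard A hA B hB)
  rw [mem_union, not_or] at hcAB
  refine hZW _ (hZ.insert_mem hx hA hc hcAB.1) _ (mem_memberSubfamily.1 hB).1 ?_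
  simp [hcAB.2, (hx c hc).ne', (mem_memberSubfamily.1 hA).2, hAB]

theorem IsShiftedOn.card_union_le_of_mem_memberSubfamily (hZ : IsShiftedOn (insert x S) Z)
    (hx : ∀ y ∈ S, y < x) {r : ℕ} (hunion : ∀ A ∈ Z, ∀ B ∈ Z, #(A ∪ B) ≤ r + 2) (hr : r + 1 < #S)
    {A B : Finset α} (hA : A ∈ Z.memberSubfamily x) (hB : B ∈ Z.memberSubfamily x) :
    #(A ∪ B) ≤ r := by
  have hA' := mem_memberSubfamily.1 hA
  have hB' := mem_memberSubfamily.1 hB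
  have hle : #(A ∪ B) ≤ r + 1 := by
    have := hunion _ hA'.1 _ hB'.1
    rw [← insert_union_distrib, card_insert_of_notMem (by simp [hA'.2, hB'.2])] at this
    omega
  obtain ⟨c, hc, hcAB⟩ := exists_mem_notMem_of_card_lt_card (hle.trans_lt hr)
  have hcA : c ∉ A := fun h => hcAB (mem_union_left _ h)
  have := hunion _ (hZ.insert_mem hx hA hc hcA) _ hB'.1
  rw [insert_union, union_insert, card_insert_of_notMem (by simp [(hx c hc).ne, hcAB]),
    card_insert_of_notMem (by simp [hA'.2, hB'.2])] at this
  omega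

theorem CrossIntersecting.card_add_card_le_of_eq_zero (hZ : Z ⊆ powersetCard a S)
    (hW : W ⊆ powersetCard b S) (hZW : CrossIntersecting Z W)
    (hunion : ∀ A ∈ Z, ∀ B ∈ Z, #(A ∪ B) ≤ a + b) (hb : b ≤ #S) (h0 : a = 0 ∨ b = 0) :
    #Z + #W ≤ (#S).choose b := by
  rcases Z.eq_empty_or_nonempty with rfl | ⟨A, hA⟩
  · simpa using card_le_card hW
  have hAa := (mem_powersetCard.1 (hZ hA)).2
  have hWempty : W = ∅ := by
    refine eq_empty_of_forall_notMem fun B hB => hZW A hA B hB ?_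
    have hBb := (mem_powersetCard.1 (hW hB)).2
    rcases h0 with rfl | rfl
    · simp [card_eq_zero.1 hAa]
    · simp [card_eq_zero.1 hBb]
  have hZone : #Z ≤ 1 := by
    refine card_le_one.2 fun A hA B hB => ?_
    have hAa := (mem_powersetCard.1 (hZ hA)).2
    have hBa := (mem_powersetCard.1 (hZ hB)).2
    rcases h0 with rfl | rfl
    · rw [card_eq_zero.1 hAa, card_eq_zero.1 hBa]
    · have hAB := hunion A hA B hB
      rw [eq_of_subset_of_card_le subset_union_left (hAB.trans hAa.ge)]
      exact (eq_of_subset_of_card_le subset_union_right (hAB.trans hBa.ge)).symm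
  rw [hWempty, card_empty, add_zero]
  exact hZone.trans (Nat.choose_pos hb)

theorem CrossIntersecting.card_add_card_le_of_add_eq (hZ : Z ⊆ powersetCard a S)
    (hW : W ⊆ powersetCard b S) (hZW : CrossIntersecting Z W) (hab : a + b = #S) :
    #Z + #W ≤ (#S).choose b := by
  have hinj : Set.InjOn (S \ ·) (Z : Set (Finset α)) := fun A hA B hB hAB => by
    rw [← Finset.sdiff_sdiff_eq_self (mem_powersetCard.1 (hZ hA)).1,
      ← Finset.sdiff_sdiff_eq_self (mem_powersetCard.1 (hZ hB)).1]
    exact congrArg (S \ ·) hAB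
  have hdisj : Disjoint (Z.image (S \ ·)) W := by
    refine disjoint_left.2 fun A' hA' hA'W => ?_
    obtain ⟨A, hA, rfl⟩ := mem_image.1 hA'
    exact hZW A hA _ hA'W disjoint_sdiff
  rw [← card_image_of_injOn hinj, ← card_union_of_disjoint hdisj, ← card_powersetCard]
  refine card_le_card (union_subset (image_subset_iff.2 fun A hA => ?_) hW)
  have hAa := mem_powersetCard.1 (hZ hA)
  rw [mem_powersetCard, card_sdiff_of_subset hAa.1, hAa.2]
  exact ⟨sdiff_subset, by omega⟩

/-- A cross-intersecting version of Katona's bound: complementation settles `a + b = #S`, and in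
general one splits both families by the last point of `S`, where shiftedness lets a member trade
this point for one lying outside both of two given members. -/
theorem IsShiftedOn.card_add_card_le (hshift : IsShiftedOn S Z) (hZ : Z ⊆ powersetCard a S)
    (hW : W ⊆ powersetCard b S) (hZW : CrossIntersecting Z W)
    (hunion : ∀ A ∈ Z, ∀ B ∈ Z, #(A ∪ B) ≤ a + b) (hab : a + b ≤ #S) :
    #Z + #W ≤ (#S).choose b := by
  induction S using Finset.induction_on_max generalizing a b Z W with
  | empty =>
    exact hZW.card_add_card_le_of_eq_zero hZ hW hunion (by omega) (by simp at hab; omega)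
  | insert x S hx ih =>
    have hxS : x ∉ S := fun h => (hx x h).false
    by_cases h0 : a = 0 ∨ b = 0
    · exact hZW.card_add_card_le_of_eq_zero hZ hW hunion (by omega) h0
    rcases hab.eq_or_lt with heq | hlt
    · exact hZW.card_add_card_le_of_add_eq hZ hW heq
    rw [not_or] at h0
    obtain ⟨a, rfl⟩ := Nat.exists_eq_add_one_of_ne_zero h0.1
    obtain ⟨b, rfl⟩ := Nat.exists_eq_add_one_of_ne_zero h0.2
    have hZmem := memberSubfamily_subset_powersetCard_erase hZ x
    have hWmem := memberSubfamily_subset_powersetCard_erase hW x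
    have hZnon := nonMemberSubfamily_subset_powersetCard_erase hZ x
    have hWnon := nonMemberSubfamily_subset_powersetCard_erase hW x
    have hshift_mem := hshift.memberSubfamily x
    have hshift_non := hshift.nonMemberSubfamily x
    rw [erase_insert hxS] at hZmem hWmem hZnon hWnon hshift_mem hshift_non
    rw [card_insert_of_notMem hxS] at hlt ⊢
    have hnon := ih hshift_non hZnon hWnon
      (fun A hA B hB => hZW A (mem_nonMemberSubfamily.1 hA).1 B (mem_nonMemberSubfamily.1 hB).1)
      (fun A hA B hB => hunion A (mem_nonMemberSubfamily.1 hA).1 B (mem_nonMemberSubfamily.1 hB).1)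
      (by omega)
    have hmem := ih hshift_mem hZmem hWmem
      (hshift.crossIntersecting_memberSubfamily hx hZW fun A hA B hB => by
        have := card_union_le A B
        rw [(mem_powersetCard.1 (hZmem hA)).2, (mem_powersetCard.1 (hWmem hB)).2] at this
        omega)
      (fun A hA B hB => hshift.card_union_le_of_mem_memberSubfamily hx (r := a + b)
        (by convert! hunion using 5; omega) (by omega) hA hB)
      (by omega)
    rw [Nat.choose_succ_succ', ← card_memberSubfamily_add_card_nonMemberSubfamily x Z,
      ← card_memberSubfamily_add_card_nonMemberSubfamily x W]
    omega

end Shifted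

section Compression

variable {α : Type*} [DecidableEq α] {i j l : α} {F : Finset (Finset α)} {A : Finset α}

theorem compress_singleton_singleton (i j : α) (A : Finset α) :
    UV.compress {i} {j} A = if i ∉ A ∧ j ∈ A then insert i (A.erase j) else A := by
  simp only [UV.compress, disjoint_singleton_left, singleton_subset_iff]
  refine ite_congr rfl (fun h => ?_) fun _ => rfl
  rw [sup_eq_union, union_singleton, sdiff_singleton_eq_erase,
    erase_insert_of_ne (ne_of_mem_of_not_mem h.2 h.1).symm]

theorem exists_of_mem_compression_of_notMem (hA : A ∈ 𝓒 {i} {j} F) (hAF : A ∉ F) :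
    ∃ B ∈ F, i ∉ B ∧ j ∈ B ∧ A = insert i (B.erase j) := by
  rcases UV.mem_compression.1 hA with h | ⟨-, B, hB, h⟩
  · exact absurd h.1 hAF
  · rw [compress_singleton_singleton] at h
    split_ifs at h with hij
    · exact ⟨B, hB, hij.1, hij.2, h.symm⟩
    · exact absurd (h ▸ hB) hAF

theorem insert_erase_mem_of_mem_compression (hA : A ∈ 𝓒 {i} {j} F) (hAF : A ∈ F) (hi : i ∉ A)
    (hj : j ∈ A) : insert i (A.erase j) ∈ F := by
  rcases UV.mem_compression.1 hA with h | h
  · rw [compress_singleton_singleton, if_pos ⟨hi, hj⟩] at h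
    exact h.2
  · exact absurd hAF h.1

theorem intersecting_compression (hF : (F : Set (Finset α)).Intersecting) (i j : α) :
    ((𝓒 {i} {j} F : Finset (Finset α)) : Set (Finset α)).Intersecting := by
  have old_meets_new {A B : Finset α} (hA : A ∈ 𝓒 {i} {j} F) (hB : B ∈ 𝓒 {i} {j} F)
      (hAF : A ∈ F) (hBF : B ∉ F) : ¬ Disjoint A B := by
    obtain ⟨B, hB', hiB, -, rfl⟩ := exists_of_mem_compression_of_notMem hB hBF
    rw [disjoint_insert_right, ← disjoint_erase_comm]
    rintro ⟨hiA, hAB⟩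
    by_cases hjA : j ∈ A
    · refine hF (insert_erase_mem_of_mem_compression hA hAF hiA hjA) hB' ?_
      exact disjoint_insert_left.2 ⟨hiB, hAB⟩
    · exact hF hAF hB' (erase_eq_of_notMem hjA ▸ hAB)
  intro A hA B hB
  by_cases hAF : A ∈ F <;> by_cases hBF : B ∈ F
  · exact hF hAF hBF
  · exact old_meets_new hA hB hAF hBF
  · exact fun h => old_meets_new hB hA hBF hAF h.symm
  · obtain ⟨A, -, -, -, rfl⟩ := exists_of_mem_compression_of_notMem hA hAF
    obtain ⟨B, -, -, -, rfl⟩ := exists_of_mem_compression_of_notMem hB hBF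
    exact not_disjoint_iff.2 ⟨i, mem_insert_self _ _, mem_insert_self _ _⟩

theorem compression_subset_powersetCard [Fintype α] {r : ℕ} (hF : F ⊆ powersetCard r univ)
    (i j : α) : 𝓒 {i} {j} F ⊆ powersetCard r univ := by
  rw [subset_powersetCard_univ_iff] at hF ⊢
  exact hF.uvCompression rfl

theorem nonMemberSubfamily_nonMemberSubfamily_subset_compression :
    (F.nonMemberSubfamily i).nonMemberSubfamily j ⊆ (𝓒 {i} {j} F).nonMemberSubfamily i := by
  intro A hA
  simp only [mem_nonMemberSubfamily] at hA ⊢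
  have hcompress := UV.compress_mem_compression (u := {i}) (v := {j}) hA.1.1
  rw [compress_singleton_singleton, if_neg fun h => hA.2 h.2] at hcompress
  exact ⟨hcompress, hA.1.2⟩

theorem card_nonMemberSubfamily_le_compression (hl : l ≠ i) :
    #(F.nonMemberSubfamily l) ≤ #((𝓒 {i} {j} F).nonMemberSubfamily l) := by
  rw [← UV.card_compression {i} {j} (F.nonMemberSubfamily l)]
  refine card_le_card fun A hA => ?_
  rcases UV.mem_compression.1 hA with ⟨hA, hA'⟩ | ⟨hAF, -⟩
  · rw [mem_nonMemberSubfamily] at hA hA' ⊢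
    exact ⟨UV.mem_compression.2 (.inl ⟨hA.1, hA'.1⟩), hA.2⟩
  · obtain ⟨B, hB, hiB, hjB, rfl⟩ := exists_of_mem_compression_of_notMem hA hAF
    rw [mem_nonMemberSubfamily] at hB
    have hlA : l ∉ insert i (B.erase j) := by simp [hl, hB.2]
    refine mem_nonMemberSubfamily.2 ⟨UV.mem_compression.2 (.inr ⟨fun h => hAF ?_, B, hB.1, ?_⟩),
      hlA⟩
    · exact mem_nonMemberSubfamily.2 ⟨h, hlA⟩
    · rw [compress_singleton_singleton, if_pos ⟨hiB, hjB⟩]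

end Compression

section ShiftingInduction

variable {n : ℕ} {F : Finset (Finset (Fin n))}

theorem sum_compress_lt {i j : Fin n} (hij : i < j) {A : Finset (Fin n)}
    (hA : UV.compress {i} {j} A ≠ A) : ∑ y ∈ UV.compress {i} {j} A, y.val < ∑ y ∈ A, y.val := by
  rw [compress_singleton_singleton] at hA ⊢
  split_ifs at hA ⊢ with h
  · rw [sum_insert fun hi => h.1 (mem_of_mem_erase hi), ← add_sum_erase A _ h.2]
    exact Nat.add_lt_add_right hij _
  · exact absurd rfl hA

theorem sum_sum_compression_lt {i j : Fin n} (hij : i < j) (hne : 𝓒 {i} {j} F ≠ F) :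
    ∑ A ∈ 𝓒 {i} {j} F, ∑ y ∈ A, y.val < ∑ A ∈ F, ∑ y ∈ A, y.val := by
  have hunion : {A ∈ F | UV.compress {i} {j} A ∈ F} ∪ {A ∈ F | UV.compress {i} {j} A ∉ F} = F :=
    filter_union_filter_not_eq _ _
  have hmoved : {A ∈ F | UV.compress {i} {j} A ∉ F}.Nonempty := by
    rw [nonempty_iff_ne_empty]
    intro hempty
    rw [hempty, union_empty] at hunion
    exact hne (by rw [UV.compression, filter_image, hempty, image_empty, union_empty, hunion])
  conv_rhs => rw [← hunion]
  rw [UV.compression, sum_union UV.compress_disjoint, sum_union (disjoint_filter_filter_not _ _ _),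
    add_lt_add_iff_left, filter_image, sum_image UV.compress_injOn]
  refine sum_lt_sum_of_nonempty hmoved fun A hA => sum_compress_lt hij fun heq => ?_
  rw [mem_filter, heq] at hA
  exact hA.2 hA.1

theorem isShiftedOn_univ_of_forall_compression_eq
    (h : ∀ i j : Fin n, i < j → 𝓒 {i} {j} F = F) : IsShiftedOn univ F := by
  intro A hA j hj i _ hi hij
  have hcompress := UV.compress_mem_compression (u := {i}) (v := {j}) hA
  rwa [compress_singleton_singleton, if_pos ⟨hi, hj⟩, h i j hij] at hcompress

theorem shifting_induction {P : Finset (Finset (Fin n)) → Prop}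
    (shifted : ∀ F, IsShiftedOn univ F → P F)
    (compression : ∀ F i j, i < j → P (𝓒 {i} {j} F) → P F) (F : Finset (Finset (Fin n))) :
    P F := by
  by_cases hF : ∀ i j : Fin n, i < j → 𝓒 {i} {j} F = F
  · exact shifted F (isShiftedOn_univ_of_forall_compression_eq hF)
  · push Not at hF
    obtain ⟨i, j, hij, hne⟩ := hF
    have := sum_sum_compression_lt hij hne
    exact compression F i j hij (shifting_induction shifted compression _)
termination_by ∑ A ∈ F, ∑ y ∈ A, y.val

end ShiftingInduction

section Pair

variable {α : Type*} [DecidableEq α] {F : Finset (Finset α)} {S : Finset α} {i j : α} {N a : ℕ}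

theorem nonMemberSubfamily_comm (F : Finset (Finset α)) (i j : α) :
    (F.nonMemberSubfamily i).nonMemberSubfamily j =
      (F.nonMemberSubfamily j).nonMemberSubfamily i := by
  simp only [nonMemberSubfamily, filter_comm]

theorem nonMemberSubfamily_memberSubfamily_comm (F : Finset (Finset α)) (hij : i ≠ j) :
    (F.memberSubfamily i).nonMemberSubfamily j = (F.nonMemberSubfamily j).memberSubfamily i := by
  ext A
  simp only [mem_memberSubfamily, mem_nonMemberSubfamily, mem_insert, hij.symm, false_or]
  tauto

theorem CrossIntersectingSizes.of_pair (hS : #S = N + 2) (hF : F ⊆ powersetCard (a + 2) S)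
    (hint : (F : Set (Finset α)).Intersecting) (hi : i ∈ S) (hj : j ∈ S) (hij : i ≠ j) :
    CrossIntersectingSizes N (a + 1) (a + 1) #((F.memberSubfamily i).nonMemberSubfamily j)
      #((F.nonMemberSubfamily i).memberSubfamily j) := by
  have hFi := memberSubfamily_subset_powersetCard_erase hF i
  have hFi' := nonMemberSubfamily_subset_powersetCard_erase hF i
  refine .of_finset ?_ (nonMemberSubfamily_subset_powersetCard_erase hFi j)
    (memberSubfamily_subset_powersetCard_erase hFi' j)
    (((CrossIntersecting.of_intersecting hint).memberSubfamily_nonMemberSubfamily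
      i).nonMemberSubfamily_memberSubfamily j)
  rw [card_erase_of_mem (mem_erase.2 ⟨hij.symm, hj⟩), card_erase_of_mem hi, hS]
  rfl

end Pair

section ShiftedPair

variable {α : Type*} [LinearOrder α] {F : Finset (Finset α)} {S : Finset α} {i j : α}

theorem IsShiftedOn.one_lt_card_inter (hshift : IsShiftedOn S F)
    (hint : (F : Set (Finset α)).Intersecting) (hi : i ∈ S) {A B : Finset α} (hA : A ∈ F)
    (hB : B ∈ F) (hiA : ∀ y ∈ A, i < y) (hiB : i ∉ B) : 1 < #(A ∩ B) := by
  obtain ⟨x, hxA, hxB⟩ := not_disjoint_iff.1 (hint hA hB)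
  obtain ⟨y, hyA, hyB⟩ := not_disjoint_iff.1
    (hint (hshift A hA x hxA i hi (fun h => (hiA i h).false) (hiA x hxA)) hB)
  rw [mem_insert, mem_erase] at hyA
  have hyA := hyA.resolve_left (ne_of_mem_of_not_mem hyB hiB)
  exact one_lt_card.2 ⟨y, mem_inter.2 ⟨hyA.2, hyB⟩, x, mem_inter.2 ⟨hxA, hxB⟩, hyA.1⟩

theorem IsShiftedOn.shadow_nonMemberSubfamily_subset (hshift : IsShiftedOn S F) (hi : i ∈ S)
    (hlt : ∀ A ∈ (F.nonMemberSubfamily i).nonMemberSubfamily j, ∀ y ∈ A, i < y) :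
    ∂ ((F.nonMemberSubfamily i).nonMemberSubfamily j)
      ⊆ (F.memberSubfamily i).nonMemberSubfamily j := by
  intro T hT
  obtain ⟨A, hA, y, hy, rfl⟩ := mem_shadow_iff.1 hT
  have hiy := hlt A hA y hy
  simp only [mem_nonMemberSubfamily] at hA
  rw [mem_nonMemberSubfamily, mem_memberSubfamily]
  exact ⟨⟨hshift A hA.1.1 y hy i hi hA.1.2 hiy, fun h => hA.1.2 (mem_of_mem_erase h)⟩,
    fun h => hA.2 (mem_of_mem_erase h)⟩

theorem IsShiftedOn.card_nonMember_add_card_member_le {N k : ℕ} (hshift : IsShiftedOn S F)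
    (hS : #S = N + 2) (hF : F ⊆ powersetCard (k + 2) S) (hint : (F : Set (Finset α)).Intersecting)
    (hi : i ∈ S) (hj : j ∈ S) (hij : i ≠ j) (hmin : ∀ y ∈ S.erase i, i < y)
    (hN : 2 * k + 2 ≤ N) :
    #((F.nonMemberSubfamily i).nonMemberSubfamily j) + #((F.memberSubfamily i).memberSubfamily j)
      ≤ N.choose k := by
  have hZ := nonMemberSubfamily_subset_powersetCard_erase
    (nonMemberSubfamily_subset_powersetCard_erase hF i) j
  have hW := memberSubfamily_subset_powersetCard_erase
    (memberSubfamily_subset_powersetCard_erase hF i) j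
  have hZW := ((CrossIntersecting.of_intersecting hint).nonMemberSubfamily_memberSubfamily
    i).nonMemberSubfamily_memberSubfamily j
  have hcard : #((S.erase i).erase j) = N := by
    rw [card_erase_of_mem (mem_erase.2 ⟨hij.symm, hj⟩), card_erase_of_mem hi, hS]
    rfl
  rw [← hcard]
  refine ((hshift.nonMemberSubfamily i).nonMemberSubfamily j).card_add_card_le hZ hW hZW
    (fun A hA B hB => ?_) (by omega)
  have hAS := mem_powersetCard.1 (hZ hA)
  have hBS := mem_powersetCard.1 (hZ hB)
  simp only [mem_nonMemberSubfamily] at hA hB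
  have := hshift.one_lt_card_inter hint hi hA.1.1 hB.1.1
    (fun y hy => hmin y (mem_of_mem_erase (hAS.1 hy))) hB.1.2
  have := card_union_add_card_inter A B
  omega

end ShiftedPair

theorem choose_le_card_shadow {α : Type*} [DecidableEq α] [Fintype α] {𝒜 : Finset (Finset α)}
    {r m c : ℕ} (h𝒜 : (𝒜 : Set (Finset α)).Sized r)
    (hr : (Fintype.card α - r + 1) * (c + 1) ≤ r * (m + 1))
    (hcard : (m + 1).choose (c + 1) ≤ #𝒜) : m.choose c ≤ #(∂ 𝒜) := by
  rcases Nat.eq_zero_or_pos r with rfl | hrpos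
  · simp at hr
  refine Nat.le_of_mul_le_mul_right ?_ (Nat.mul_pos hrpos m.succ_pos)
  calc m.choose c * (r * (m + 1)) = (m + 1).choose (c + 1) * r * (c + 1) := by
        rw [mul_left_comm, mul_comm (m.choose c), Nat.add_one_mul_choose_eq]
        ring
    _ ≤ #𝒜 * r * (c + 1) := by gcongr
    _ ≤ #(∂ 𝒜) * (Fintype.card α - r + 1) * (c + 1) := by
        exact Nat.mul_le_mul_right _ (local_lubell_yamamoto_meshalkin_inequality_mul h𝒜)
    _ ≤ #(∂ 𝒜) * (r * (m + 1)) := by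
        rw [mul_assoc]
        gcongr

section Diversity

variable {n : ℕ} {F : Finset (Finset (Fin n))}

theorem familyMaxDegree_add_diversity (F : Finset (Finset (Fin n))) :
    familyMaxDegree F + diversity F = #F :=
  Nat.add_sub_of_le (familyMaxDegree_le_card F)

theorem familyDegree_eq_card_memberSubfamily (F : Finset (Finset (Fin n))) (i : Fin n) :
    familyDegree F i = #(F.memberSubfamily i) := by
  rw [memberSubfamily, card_image_of_injOn, familyDegree]
  exact (erase_injOn' i).mono fun A hA => (mem_filter.1 hA).2

theorem diversity_le_card_nonMemberSubfamily (F : Finset (Finset (Fin n))) (i : Fin n) :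
    diversity F ≤ #(F.nonMemberSubfamily i) := by
  have hle : familyDegree F i ≤ familyMaxDegree F := le_sup (f := familyDegree F) (mem_univ i)
  have := card_memberSubfamily_add_card_nonMemberSubfamily i F
  have := familyMaxDegree_add_diversity F
  rw [familyDegree_eq_card_memberSubfamily] at hle
  omega

theorem exists_card_memberSubfamily_eq_familyMaxDegree [NeZero n] (F : Finset (Finset (Fin n))) :
    ∃ i, #(F.memberSubfamily i) = familyMaxDegree F ∧ #(F.nonMemberSubfamily i) = diversity F := by
  obtain ⟨i, -, hi⟩ := exists_mem_eq_sup (univ : Finset (Fin n)) univ_nonempty (familyDegree F)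
  have := card_memberSubfamily_add_card_nonMemberSubfamily i F
  have := familyMaxDegree_add_diversity F
  rw [← familyMaxDegree, familyDegree_eq_card_memberSubfamily] at hi
  exact ⟨i, by omega, by omega⟩

theorem crossIntersectingSizes_familyMaxDegree_diversity {N a : ℕ}
    {F : Finset (Finset (Fin (N + 1)))} (hF : F ⊆ powersetCard (a + 1) univ)
    (hint : (F : Set (Finset (Fin (N + 1)))).Intersecting) :
    CrossIntersectingSizes N a (a + 1) (familyMaxDegree F) (diversity F) := by
  obtain ⟨x, hmax, hdiv⟩ := exists_card_memberSubfamily_eq_familyMaxDegree F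
  rw [← hmax, ← hdiv]
  exact .of_finset (by simp) (memberSubfamily_subset_powersetCard_erase hF x)
    (nonMemberSubfamily_subset_powersetCard_erase hF x)
    ((CrossIntersecting.of_intersecting hint).memberSubfamily_nonMemberSubfamily x)

theorem diversity_le_card_nonMemberSubfamily_add {i j : Fin n} (hij : i ≠ j) :
    diversity F ≤ #((F.memberSubfamily i).nonMemberSubfamily j)
      + #((F.nonMemberSubfamily i).nonMemberSubfamily j) := by
  rw [nonMemberSubfamily_memberSubfamily_comm F hij, nonMemberSubfamily_comm,
    card_memberSubfamily_add_card_nonMemberSubfamily]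
  exact diversity_le_card_nonMemberSubfamily F j

theorem diversity_le_card_memberSubfamily_add (F : Finset (Finset (Fin n))) (i j : Fin n) :
    diversity F ≤ #((F.nonMemberSubfamily i).memberSubfamily j)
      + #((F.nonMemberSubfamily i).nonMemberSubfamily j) := by
  rw [card_memberSubfamily_add_card_nonMemberSubfamily]
  exact diversity_le_card_nonMemberSubfamily F i

end Diversity

section LargeDiversity

variable {M c : ℕ} {F : Finset (Finset (Fin (M + 4)))} {i j : Fin (M + 4)}

theorem choose_lt_card_nonMemberSubfamily_nonMemberSubfamily (hF : F ⊆ powersetCard (c + 3) univ)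
    (hint : (F : Set (Finset (Fin (M + 4)))).Intersecting) (hM : 2 * c + 2 ≤ M)
    (hdiv : (M + 1).choose (c + 1) + M.choose (c + 1) < diversity F) (hij : i ≠ j) :
    M.choose (c + 1) < #((F.nonMemberSubfamily i).nonMemberSubfamily j) := by
  by_contra! hle
  have hX := diversity_le_card_nonMemberSubfamily_add (F := F) hij
  have hY := diversity_le_card_memberSubfamily_add F i j
  have hcross := CrossIntersectingSizes.of_pair (card_fin (M + 4)) hF hint (mem_univ i) (mem_univ j)
    hij
  have := hcross.left_le_of_choose_le (m := M + 1) (by omega) (by omega)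
  omega

theorem choose_lt_diversity_compression (hF : F ⊆ powersetCard (c + 3) univ)
    (hint : (F : Set (Finset (Fin (M + 4)))).Intersecting) (hM : 2 * c + 2 ≤ M)
    (hdiv : (M + 1).choose (c + 1) + M.choose (c + 1) < diversity F) (hij : i ≠ j) :
    M.choose c < diversity (𝓒 {i} {j} F) := by
  have hmono : M.choose c ≤ M.choose (c + 1) :=
    choose_le_choose_of_add_le (by omega) (by omega)
  obtain ⟨l, -, hl⟩ := exists_card_memberSubfamily_eq_familyMaxDegree (𝓒 {i} {j} F)
  rw [← hl]
  rcases eq_or_ne l i with rfl | hli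
  · have hZ := choose_lt_card_nonMemberSubfamily_nonMemberSubfamily hF hint hM hdiv hij
    exact (hmono.trans_lt hZ).trans_le
      (card_le_card nonMemberSubfamily_nonMemberSubfamily_subset_compression)
  · have := diversity_le_card_nonMemberSubfamily F l
    have := card_nonMemberSubfamily_le_compression (F := F) (j := j) hli
    omega

theorem choose_le_card_of_isShiftedOn (hshift : IsShiftedOn univ F)
    (hF : F ⊆ powersetCard (c + 3) univ) (hM : 2 * c + 2 ≤ M)
    (hdiv : (M + 1).choose (c + 1) + M.choose c ≤ diversity F) :
    M.choose c ≤ #((F.memberSubfamily 0).nonMemberSubfamily 1) ∧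
      M.choose c ≤ #((F.nonMemberSubfamily 0).memberSubfamily 1) := by
  have h01 : (0 : Fin (M + 4)) ≠ 1 := by simp
  rcases Nat.lt_or_ge #((F.nonMemberSubfamily 0).nonMemberSubfamily 1) ((M + 1).choose (c + 1))
    with hlt | hge
  · have := diversity_le_card_nonMemberSubfamily_add (F := F) h01
    have := diversity_le_card_memberSubfamily_add F 0 1
    omega
  have hZ := nonMemberSubfamily_subset_powersetCard_erase
    (nonMemberSubfamily_subset_powersetCard_erase hF 0) 1
  have hshadow := choose_le_card_shadow (r := c + 3) (m := M) (c := c)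
    (fun A hA => (mem_powersetCard.1 (hZ hA)).2) (by
      rw [Fintype.card_fin, show M + 4 - (c + 3) + 1 = M + 2 - c by omega]
      nlinarith [Nat.sub_le (M + 2) c]) hge
  have hlt₀ : ∀ A ∈ (F.nonMemberSubfamily 0).nonMemberSubfamily 1, ∀ y ∈ A, 0 < y := by
    intro A hA y hy
    have : y ≠ 0 := ne_of_mem_of_not_mem hy
      (mem_nonMemberSubfamily.1 (mem_nonMemberSubfamily.1 hA).1).2
    exact Fin.pos_of_ne_zero this
  have hlt₁ : ∀ A ∈ (F.nonMemberSubfamily 1).nonMemberSubfamily 0, ∀ y ∈ A, 1 < y := by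
    intro A hA y hy
    obtain ⟨hA1, hA0⟩ := mem_nonMemberSubfamily.1 hA
    have hy0 : y ≠ 0 := ne_of_mem_of_not_mem hy hA0
    have hy1 : y ≠ 1 := ne_of_mem_of_not_mem hy (mem_nonMemberSubfamily.1 hA1).2
    rw [Ne, Fin.ext_iff] at hy0 hy1
    simp only [Fin.val_zero, Fin.val_one, Fin.lt_def] at *
    omega
  have hX := hshift.shadow_nonMemberSubfamily_subset (mem_univ 0) hlt₀
  have hY := hshift.shadow_nonMemberSubfamily_subset (mem_univ 1) hlt₁
  rw [nonMemberSubfamily_comm, nonMemberSubfamily_memberSubfamily_comm F h01.symm] at hY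
  exact ⟨hshadow.trans (card_le_card hX), hshadow.trans (card_le_card hY)⟩

theorem card_le_of_isShiftedOn (hshift : IsShiftedOn univ F)
    (hF : F ⊆ powersetCard (c + 3) univ) (hint : (F : Set (Finset (Fin (M + 4)))).Intersecting)
    (hM : 2 * c + 2 ≤ M) (hdiv : (M + 1).choose (c + 1) + M.choose c ≤ diversity F) :
    #F ≤ (M + 2).choose (c + 1) + 2 * (M + 1).choose (c + 1) := by
  have h01 : (0 : Fin (M + 4)) ≠ 1 := by simp
  obtain ⟨hX, hY⟩ := choose_le_card_of_isShiftedOn hshift hF hM hdiv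
  have hXY := (CrossIntersectingSizes.of_pair (card_fin (M + 4)) hF hint (mem_univ 0)
    (mem_univ 1) h01).add_le_two_mul_choose hM hX hY
  have hZW := hshift.card_nonMember_add_card_member_le (card_fin (M + 4)) hF hint (mem_univ 0)
    (mem_univ 1) h01 (fun y hy => Fin.pos_of_ne_zero (ne_of_mem_erase hy)) (by omega)
  rw [← card_memberSubfamily_add_card_nonMemberSubfamily 0 F,
    ← card_memberSubfamily_add_card_nonMemberSubfamily 1 (F.memberSubfamily 0),
    ← card_memberSubfamily_add_card_nonMemberSubfamily 1 (F.nonMemberSubfamily 0)]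
  omega

theorem card_le_of_choose_lt_diversity (hF : F ⊆ powersetCard (c + 3) univ)
    (hint : (F : Set (Finset (Fin (M + 4)))).Intersecting) (hM : 2 * c + 2 ≤ M)
    (hdiv : M.choose c < diversity F) :
    #F ≤ (M + 2).choose (c + 1) + 2 * (M + 1).choose (c + 1) := by
  have card_le_of_le {F : Finset (Finset (Fin (M + 4)))} (hF : F ⊆ powersetCard (c + 3) univ)
      (hint : (F : Set (Finset (Fin (M + 4)))).Intersecting) (hdiv : M.choose c < diversity F)
      (hle : diversity F ≤ (M + 1).choose (c + 1) + M.choose (c + 1)) :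
      #F ≤ (M + 2).choose (c + 1) + 2 * (M + 1).choose (c + 1) := by
    rw [← familyMaxDegree_add_diversity]
    exact (crossIntersectingSizes_familyMaxDegree_diversity hF
      hint).add_le_of_le_choose_add_choose hM hdiv.le hle
  have hmono : M.choose c ≤ M.choose (c + 1) := choose_le_choose_of_add_le (by omega) (by omega)
  induction F using shifting_induction with
  | shifted F hshift =>
    rcases Nat.le_total (diversity F) ((M + 1).choose (c + 1) + M.choose (c + 1)) with hle | hge
    · exact card_le_of_le hF hint hdiv hle
    · exact card_le_of_isShiftedOn hshift hF hint hM (by omega)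
  | compression F i j hij ih =>
    rcases le_or_gt (diversity F) ((M + 1).choose (c + 1) + M.choose (c + 1)) with hle | hlt
    · exact card_le_of_le hF hint hdiv hle
    · rw [← UV.card_compression {i} {j} F]
      exact ih (compression_subset_powersetCard hF i j) (intersecting_compression hint i j)
        (choose_lt_diversity_compression hF hint hM hlt hij.ne)

end LargeDiversity

section DiversityTheorem

theorem choose_add_choose_eq (M c : ℕ) :
    (M + 3).choose (c + 2) + M.choose c
      = M.choose (c + 2) + (M + 2).choose (c + 1) + 2 * (M + 1).choose (c + 1) := by
  have := Nat.choose_succ_succ' (M + 2) (c + 1)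
  have := Nat.choose_succ_succ' (M + 1) (c + 1)
  have := Nat.choose_succ_succ' M (c + 1)
  have := Nat.choose_succ_succ' M c
  simp only [add_assoc, Nat.reduceAdd] at *
  omega

theorem choose_add_choose_le_choose_add_choose {M c : ℕ} (hM : 2 * c + 4 ≤ M) :
    (M + 3).choose (c + 2) + 2 * (M + 2).choose (c + 2) + M.choose (c + 3)
        + (M - (c + 1)).choose (c + 2)
      ≤ (M + 4).choose (c + 3) + M.choose c + 1 := by
  have hle := choose_add_choose_sub_le (m := M) (show c + 1 < c + 2 by omega) (by omega)
  have hid := choose_add_choose_eq (M + 1) (c + 1)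
  have := Nat.choose_succ_succ' M c
  have := Nat.choose_succ_succ' M (c + 2)
  simp only [add_assoc, Nat.reduceAdd] at *
  omega

variable {n k u : ℕ} {F : Finset (Finset (Fin n))}

theorem card_add_le_of_choose_lt_diversity_of_le (hkn : 2 * k < n) (hF : F ⊆ powersetCard k univ)
    (hint : (F : Set (Finset (Fin n))).Intersecting) (hu : 4 ≤ u) (huk : u ≤ k)
    (hdiv : (n - u - 1).choose (k - u) < diversity F)
    (hle : diversity F ≤ (n - u).choose (k - u + 1)) :
    #F + (n - u - 1).choose (k - 1) + (n - k - 2).choose (k - 2)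
      ≤ (n - 1).choose (k - 1) + (n - u - 1).choose (k - u) + 1 := by
  obtain ⟨r, rfl⟩ : ∃ r, u = r + 1 := ⟨u - 1, by omega⟩
  obtain ⟨m, rfl⟩ : ∃ m, n = m + 1 + r + 1 := ⟨n - r - 2, by omega⟩
  obtain ⟨c, rfl⟩ : ∃ c, k = c + r + 1 := ⟨k - r - 1, by omega⟩
  rw [← familyMaxDegree_add_diversity]
  have hsizes := crossIntersectingSizes_familyMaxDegree_diversity hF hint
  obtain ⟨a, ha⟩ : ∃ a, c + r = a + 1 := ⟨c + r - 1, by omega⟩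
  rw [show c + r + 1 = c + 1 + r by omega, ha] at hsizes
  rw [show m + 1 + r + 1 - (r + 1) - 1 = m by omega, show c + r + 1 - (r + 1) = c by omega]
    at hdiv ⊢
  rw [show m + 1 + r + 1 - (r + 1) = m + 1 by omega, show c + r + 1 - (r + 1) = c by omega] at hle
  rw [show m + 1 + r + 1 - (c + r + 1) - 2 = m - (c + 1) by omega,
    show c + r + 1 - 2 = a by omega, Nat.add_sub_cancel, Nat.add_sub_cancel, ha]
  exact hsizes.add_le_of_choose_lt_of_le (by omega) (by omega) hdiv hle

theorem card_add_le_of_choose_lt_diversity (hkn : 2 * k < n) (hF : F ⊆ powersetCard k univ)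
    (hint : (F : Set (Finset (Fin n))).Intersecting) (hu : 4 ≤ u) (huk : u ≤ k)
    (hdiv : (n - u - 1).choose (k - u) < diversity F) :
    #F + (n - u - 1).choose (k - 1) + (n - k - 2).choose (k - 2)
      ≤ (n - 1).choose (k - 1) + (n - u - 1).choose (k - u) + 1 := by
  induction u, hu using Nat.le_induction with
  | base =>
    rcases le_or_gt (diversity F) ((n - 4).choose (k - 4 + 1)) with hle | hlt
    · exact card_add_le_of_choose_lt_diversity_of_le hkn hF hint le_rfl huk hdiv hle
    obtain ⟨M, rfl⟩ : ∃ M, n = M + 5 := ⟨n - 5, by omega⟩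
    obtain ⟨c, rfl⟩ : ∃ c, k = c + 4 := ⟨k - 4, by omega⟩
    have hcard := card_le_of_choose_lt_diversity (M := M + 1) (c := c + 1) hF hint (by omega) hlt
    have hbinom := choose_add_choose_le_choose_add_choose (M := M) (c := c) (by omega)
    rw [show M + 5 - (c + 4) - 2 = M - (c + 1) by omega]
    simp only [add_assoc, Nat.reduceAdd, Nat.add_sub_cancel, Nat.reduceSubDiff] at *
    omega
  | succ u hu ih =>
    rcases le_or_gt (diversity F) ((n - (u + 1)).choose (k - (u + 1) + 1)) with hle | hlt
    · exact card_add_le_of_choose_lt_diversity_of_le hkn hF hint (by omega) huk hdiv hle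
    obtain ⟨M, hM⟩ : ∃ M, n = M + 1 + u + 1 := ⟨n - u - 2, by omega⟩
    obtain ⟨c, hc⟩ : ∃ c, k = c + 1 + u := ⟨k - u - 1, by omega⟩
    have hmono : M.choose (c + 1) ≤ M.choose (k - 2) :=
      choose_le_choose_of_add_le (by omega) (by omega)
    have hpascal := Nat.choose_succ_succ' M c
    have hpascal' := Nat.choose_succ_succ' M (k - 2)
    rw [show n - (u + 1) = M + 1 by omega, show k - (u + 1) = c by omega] at hlt ⊢
    rw [show n - u - 1 = M + 1 by omega, show k - u = c + 1 by omega] at ih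
    have hbound := ih (by omega) hlt
    rw [show k - 2 + 1 = k - 1 by omega] at hpascal'
    rw [Nat.add_sub_cancel]
    omega

theorem card_add_le_of_choose_lt_diversity_of_range (hk : 3 ≤ k) (hkn : 2 * k < n)
    (hF : F ⊆ powersetCard k univ) (hint : (F : Set (Finset (Fin n))).Intersecting)
    (hdiv : (n - 4).choose (k - 3) < diversity F ∧
        diversity F + (n - k - 2).choose (k - 2) ≤ (n - 3).choose (k - 2) + 1 ∨
      (n - 3).choose (k - 2) < diversity F ∧
        diversity F + (n - k - 2).choose (k - 2)
          ≤ (n - 3).choose (k - 2) + (n - 4).choose (k - 2) + 1) :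
    #F + (n - 4).choose (k - 1) + (n - k - 2).choose (k - 2)
      ≤ (n - 1).choose (k - 1) + (n - 4).choose (k - 3) + 1 := by
  obtain ⟨M, rfl⟩ : ∃ M, n = M + 4 := ⟨n - 4, by omega⟩
  obtain ⟨c, rfl⟩ : ∃ c, k = c + 3 := ⟨k - 3, by omega⟩
  rw [show M + 4 - (c + 3) - 2 = M - (c + 1) by omega] at hdiv ⊢
  have hsizes := crossIntersectingSizes_familyMaxDegree_diversity hF hint
  have hbound := hsizes.add_le_of_first_or_second_range (by omega) hdiv
  have hid := choose_add_choose_eq M c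
  rw [familyMaxDegree_add_diversity] at hbound
  simp only [Nat.add_sub_cancel, Nat.reduceSubDiff]
  omega

end DiversityTheorem

theorem mainTheorem6 (n k : ℕ) (hn : 2 * k < n) (F : Finset (Finset (Fin n)))
    (hF : F ⊆ Finset.powersetCard k Finset.univ)
    (hint : (F : Set (Finset (Fin n))).Intersecting) :
    (8 ≤ 2 * k → ∀ u : ℕ, 4 ≤ u → u ≤ k →
      (n - u - 1).choose (n - k - 1) < diversity F →
      (F.card : ℤ) ≤ ((n - 1).choose (k - 1) : ℤ) + ((n - u - 1).choose (n - k - 1) : ℤ)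
        - ((n - u - 1).choose (k - 1) : ℤ) - ((n - k - 2).choose (k - 2) : ℤ) + 1) ∧
    (6 ≤ 2 * k →
      (((n - 4).choose (k - 3) < diversity F ∧
          (diversity F : ℤ) ≤ ((n - 3).choose (k - 2) : ℤ)
            - ((n - k - 2).choose (k - 2) : ℤ) + 1) ∨
        ((n - 3).choose (k - 2) < diversity F ∧
          (diversity F : ℤ) ≤ ((n - 3).choose (k - 2) : ℤ) + ((n - 4).choose (k - 2) : ℤ)
            - ((n - k - 2).choose (k - 2) : ℤ) + 1)) →
      (F.card : ℤ) ≤ ((n - 1).choose (k - 1) : ℤ) + ((n - 3 - 1).choose (n - k - 1) : ℤ)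
        - ((n - 3 - 1).choose (k - 1) : ℤ) - ((n - k - 2).choose (k - 2) : ℤ) + 1) := by
  refine ⟨fun hk u hu huk hdiv => ?_, fun hk hdiv => ?_⟩
  · rw [Nat.choose_symm_of_eq_add (show n - u - 1 = (n - k - 1) + (k - u) by omega)] at hdiv ⊢
    have := card_add_le_of_choose_lt_diversity hn hF hint hu huk hdiv
    omega
  · rw [show n - 3 - 1 = n - 4 by omega,
      Nat.choose_symm_of_eq_add (show n - 4 = (n - k - 1) + (k - 3) by omega)]
    have := card_add_le_of_choose_lt_diversity_of_range (by omega) hn hF hint (by omega)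
    omega
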